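/- Let $\mathcal H$ be a complex Hilbert space and let $T\in\mathcal B(\mathcal H)$ be a pure quasinormal operator: $T$ commutes with its modulus $|T|=(T^*T)^{1/2}$, and there is no closed reducing subspace $\mathcal M\neq\{0\}$ of $T$ such that $T|_{\mathcal M}$ is normal. Let $T=V_T|T|$ be the polar decomposition, put $\mathfrak L_T=\mathcal H\ominus V_T\mathcal H$, which is invariant under $|T|$, and let $A_T=|T|\,|_{\mathfrak L_T}$. Identify $\mathfrak L_T\otimes H^2$ with $\bigoplus_{k\ge 0}\mathfrak L_T$, where $S$ is the unilateral shift on $H^2$, so that $I\otimes S$ is the map $(x_0,x_1,\dots)\mapsto(0,x_0,x_1,\dots)$ and $A_T\otimes S$ is the map $(x_0,x_1,\dots)\mapsto(0,A_Tx_0,A_Tx_1,\dots)$. Let $\sigma_{ext}(T)$ be the set of $\lambda\in\mathbb C$ for which there is a nonzero $X\in\mathcal B(\mathcal H)$ (an extended eigenvector for $\lambda$) with $TX=\lambda XT$, and let $E_{ext}(T,\lambda)$ be the linear span of the extended eigenvectors for $\lambda$. For $r>0$ let \[ \mathcal A_r(A_T)=\{L\in\mathcal B(\mathfrak L_T):\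 \exists c\ge 0\ \ \forall x\in\mathfrak L_T\ \ \forall n\in\mathbb N,\ \ \|r^{-n}A_T^nLx\|\le c\|A_T^nx\|\}. \] Let $\lambda\in\sigma_{ext}(T)$ (so $\lambda\ne0$). Then there is a unitary operator $U_T:\mathcal H\to\mathfrak L_T\otimes H^2$ with $U_TTU_T^*=A_T\otimes S$, and for every such $U_T$, \[ E_{ext}(T,\lambda)=\overline{\operatorname{span}}^{\,w^*}\bigl\{U_T^*(I\otimes S^m)\,\mathrm{diag}(L,X_{1,1},X_{2,2},\dots)\,U_T:\ m\in\mathbb N,\ L\in\mathcal A_{|\lambda|}(A_T)\bigr\}, \] where the closure of the linear span is taken in the weak* topology of $\mathcal B(\mathcal H)$ (as the dual of the trace class operators), $\mathbb N$ contains $0$, and, for each $L$ and $n\ge1$, $X_{n,n}\in\mathcal B(\mathfrak L_T)$ is the unique bounded extension to $\mathfrak L_T$ of the map $A_T^nx\mapsto\lambda^{-n}A_T^nLx$ defined on the (dense) range of $A_T^n$. -/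

import Mathlib

open scoped InnerProductSpace ENNReal

noncomputable section

namespace ExtEig

universe u

variable {H : Type u} [NormedAddCommGroup H] [InnerProductSpace ℂ H] [CompleteSpace H]

/-! ### Extended eigenvalues and extended eigenspaces -/

/-- `X` satisfies `T X = lam X T` and is nonzero. -/
def IsExtEigenvector (T : H →L[ℂ] H) (lam : ℂ) (X : H →L[ℂ] H) : Prop :=
  X ≠ 0 ∧ T ∘L X = lam • (X ∘L T)

/-- The extended spectrum of `T`. -/
def extSpectrum (T : H →L[ℂ] H) : Set ℂ :=
  {lam | ∃ X : H →L[ℂ] H, IsExtEigenvector T lam X}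

/-- The subspace generated by the extended eigenvectors of `T` associated with `lam`. -/
def extEigenspace (T : H →L[ℂ] H) (lam : ℂ) : Submodule ℂ (H →L[ℂ] H) :=
  Submodule.span ℂ {X | IsExtEigenvector T lam X}

/-! ### The weak* topology of `B(H)` -/

/-- The weak* (that is, ultraweak) topology of `B(H)`, as the dual of the trace class operators:
the coarsest topology for which every functional `X ↦ ∑ₙ ⟪yₙ, X xₙ⟫` is continuous, where
`∑ ‖xₙ‖² < ∞` and `∑ ‖yₙ‖² < ∞`. -/
@[reducible]
def weakStarTopology (H : Type u) [NormedAddCommGroup H] [InnerProductSpace ℂ H] :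
    TopologicalSpace (H →L[ℂ] H) :=
  ⨅ (x : lp (fun _ : ℕ => H) 2) (y : lp (fun _ : ℕ => H) 2),
    TopologicalSpace.induced (fun X : H →L[ℂ] H => ∑' n, ⟪y n, X (x n)⟫_ℂ) inferInstance

/-- The weak*-closed linear span of a set of operators. -/
def weakStarSpan (s : Set (H →L[ℂ] H)) : Set (H →L[ℂ] H) :=
  @closure _ (weakStarTopology H) (Submodule.span ℂ s : Set (H →L[ℂ] H))

/-! ### Pure quasinormal operators -/

/-- `T` commutes with its modulus `|T| = (T* T)^(1/2)`. -/
def IsQuasinormal (T : H →L[ℂ] H) : Prop :=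
  T * CFC.abs T = CFC.abs T * T

/-- `T` is pure: it has no nonzero (closed) reducing subspace on which it is normal. -/
def IsPure (T : H →L[ℂ] H) : Prop :=
  ∀ (M : Submodule ℂ H) [CompleteSpace M] (hM : Set.MapsTo T M M),
    Set.MapsTo (ContinuousLinearMap.adjoint T) M M → IsStarNormal (T.restrict hM) → M = ⊥

/-- `T` is a pure quasinormal operator. -/
structure IsPureQuasinormal (T : H →L[ℂ] H) : Prop where
  quasinormal : IsQuasinormal T
  pure : IsPure T

/-! ### Polar decomposition -/

/-- The closure of the range of `|T|`, the initial space of the polar decomposition of `T`. -/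
def initialSpace (T : H →L[ℂ] H) : Submodule ℂ H :=
  (LinearMap.range (CFC.abs T).toLinearMap).topologicalClosure

instance initialSpace_complete (T : H →L[ℂ] H) : CompleteSpace (initialSpace T) :=
  (Submodule.isClosed_topologicalClosure _).completeSpace_coe

/-- `|T|` as a map into the closure of its range. -/
def absToInitial (T : H →L[ℂ] H) : H →ₗ[ℂ] initialSpace T :=
  (CFC.abs T).toLinearMap.codRestrict (initialSpace T) fun x =>
    Submodule.le_topologicalClosure _ (LinearMap.mem_range_self _ x)

/-- The partial isometry `V_T` of the polar decomposition `T = V_T |T|`: it is the continuous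
extension of `|T| x ↦ T x` on the closure of the range of `|T|`, and `0` on the orthogonal
complement. -/
def polarIsometry (T : H →L[ℂ] H) : H →L[ℂ] H :=
  (T.toLinearMap.extendOfNorm (absToInitial T)) ∘L (initialSpace T).orthogonalProjectionOnto

theorem abs_isSelfAdjoint (T : H →L[ℂ] H) : IsSelfAdjoint (CFC.abs T) :=
  IsSelfAdjoint.of_nonneg (CFC.abs_nonneg T)

theorem inner_abs_left (T : H →L[ℂ] H) (x y : H) :
    ⟪CFC.abs T x, y⟫_ℂ = ⟪x, CFC.abs T y⟫_ℂ := by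
  have h := ContinuousLinearMap.adjoint_inner_right (CFC.abs T) x y
  rw [(ContinuousLinearMap.isSelfAdjoint_iff'.mp (abs_isSelfAdjoint T))] at h
  exact h.symm

theorem norm_abs_apply (T : H →L[ℂ] H) (x : H) : ‖CFC.abs T x‖ = ‖T x‖ := by
  have h1 : ⟪CFC.abs T x, CFC.abs T x⟫_ℂ = ⟪T x, T x⟫_ℂ := by
    rw [inner_abs_left, ← mul_apply_eq_comp, CFC.abs_mul_abs,
      ContinuousLinearMap.star_eq_adjoint, mul_apply_eq_comp,
      ContinuousLinearMap.adjoint_inner_right]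
  rw [inner_self_eq_norm_sq_to_K, inner_self_eq_norm_sq_to_K] at h1
  have h2 : ‖CFC.abs T x‖ ^ 2 = ‖T x‖ ^ 2 := by exact_mod_cast h1
  exact (sq_eq_sq₀ (norm_nonneg _) (norm_nonneg _)).mp h2

theorem denseRange_absToInitial (T : H →L[ℂ] H) : DenseRange (absToInitial T) := by
  intro y
  rw [Metric.mem_closure_iff]
  intro ε hε
  have hy : (y : H) ∈ closure (LinearMap.range (CFC.abs T).toLinearMap : Set H) := by
    rw [← Submodule.topologicalClosure_coe]
    exact y.2
  obtain ⟨_, ⟨x, rfl⟩, hx⟩ := Metric.mem_closure_iff.mp hy ε hε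
  exact ⟨_, ⟨x, rfl⟩, hx⟩

/-- The polar decomposition `T = V_T |T|`. -/
theorem polarIsometry_abs (T : H →L[ℂ] H) (x : H) : polarIsometry T (CFC.abs T x) = T x := by
  have h1 : (initialSpace T).orthogonalProjectionOnto (CFC.abs T x) = absToInitial T x :=
    Submodule.orthogonalProjectionOnto_mem_subspace_eq_self (absToInitial T x)
  rw [polarIsometry, ContinuousLinearMap.comp_apply, h1]
  exact LinearMap.extendOfNorm_eq (denseRange_absToInitial T)
    ⟨1, fun z => by
      rw [one_mul]
      exact (norm_abs_apply T z).ge⟩ x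

/-- `V_T` vanishes on the kernel of `T`. -/
theorem polarIsometry_of_apply_eq_zero (T : H →L[ℂ] H) (x : H) (hx : T x = 0) :
    polarIsometry T x = 0 := by
  have h0 : CFC.abs T x = 0 := by rw [← norm_eq_zero, norm_abs_apply, hx, norm_zero]
  have h1 : x ∈ (initialSpace T)ᗮ := by
    rw [initialSpace, Submodule.orthogonal_closure, Submodule.mem_orthogonal]
    rintro _ ⟨z, rfl⟩
    change ⟪CFC.abs T z, x⟫_ℂ = 0
    rw [inner_abs_left, h0, inner_zero_right]
  rw [polarIsometry, ContinuousLinearMap.comp_apply,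
    Submodule.orthogonalProjectionOnto_apply_of_mem_orthogonal h1, map_zero]

/-- For quasinormal `T` the factors of the polar decomposition commute. -/
theorem polarIsometry_commute (T : H →L[ℂ] H) (hT : IsQuasinormal T) (x : H) :
    polarIsometry T (CFC.abs T x) = CFC.abs T (polarIsometry T x) := by
  have hc : ∀ z, T (CFC.abs T z) = CFC.abs T (T z) := fun z => congrArg (fun S => S z) hT
  have hx : x ∈ initialSpace T ⊔ (initialSpace T)ᗮ := by
    rw [Submodule.sup_orthogonal_of_hasOrthogonalProjection]
    trivial
  obtain ⟨y, hy, z, hz, rfl⟩ := Submodule.mem_sup.mp hx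
  have h1 : polarIsometry T (CFC.abs T y) = CFC.abs T (polarIsometry T y) := by
    have hcl : IsClosed {w | polarIsometry T (CFC.abs T w) = CFC.abs T (polarIsometry T w)} :=
      isClosed_eq (by fun_prop) (by fun_prop)
    have hy' : y ∈ closure (LinearMap.range (CFC.abs T).toLinearMap : Set H) := by
      rw [← Submodule.topologicalClosure_coe]
      exact hy
    refine hcl.closure_subset_iff.mpr ?_ hy'
    rintro _ ⟨w, rfl⟩
    change polarIsometry T (CFC.abs T (CFC.abs T w)) = CFC.abs T (polarIsometry T (CFC.abs T w))
    rw [polarIsometry_abs, polarIsometry_abs, hc]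
  have h0 : CFC.abs T z = 0 := by
    refine ext_inner_left ℂ fun w => ?_
    rw [← inner_abs_left, inner_zero_right]
    exact (Submodule.mem_orthogonal _ _).mp hz _
      (Submodule.le_topologicalClosure _ (LinearMap.mem_range_self _ w))
  have h2 : polarIsometry T z = 0 := polarIsometry_of_apply_eq_zero T z (by
    rw [← norm_eq_zero, ← norm_abs_apply, h0, norm_zero])
  rw [map_add, map_add, map_add, map_add, h1, h0, h2, map_zero, map_zero]

/-! ### The space `𝔏_T` and the operator `A_T` -/

/-- `𝔏_T = H ⊖ V_T H`. -/
def defectSpace (T : H →L[ℂ] H) : Submodule ℂ H :=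
  (LinearMap.range (polarIsometry T).toLinearMap)ᗮ

instance defectSpace_complete (T : H →L[ℂ] H) : CompleteSpace (defectSpace T) :=
  (Submodule.isClosed_orthogonal _).completeSpace_coe

theorem abs_mapsTo_defectSpace (T : H →L[ℂ] H) (hT : IsQuasinormal T) :
    Set.MapsTo (CFC.abs T : H →L[ℂ] H) (defectSpace T) (defectSpace T) := by
  intro x hx
  refine (Submodule.mem_orthogonal _ _).mpr ?_
  rintro _ ⟨z, rfl⟩
  change ⟪polarIsometry T z, CFC.abs T x⟫_ℂ = 0
  rw [← inner_abs_left, ← polarIsometry_commute T hT]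
  exact (Submodule.mem_orthogonal _ _).mp hx _ (LinearMap.mem_range_self _ _)

/-- `A_T`, the restriction of `|T|` to the invariant subspace `𝔏_T`. -/
def defectOp (T : H →L[ℂ] H) (hT : IsPureQuasinormal T) : defectSpace T →L[ℂ] defectSpace T :=
  (CFC.abs T).restrict (abs_mapsTo_defectSpace T hT.quasinormal)

/-- A pure quasinormal operator is injective. -/
theorem ker_eq_bot (T : H →L[ℂ] H) (hT : IsPureQuasinormal T) :
    LinearMap.ker T.toLinearMap = ⊥ := by
  have habs : ∀ x, T x = 0 ↔ CFC.abs T x = 0 := fun x => by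
    rw [← norm_eq_zero, ← norm_abs_apply, norm_eq_zero]
  have hcl : IsClosed (LinearMap.ker T.toLinearMap : Set H) := T.isClosed_ker
  have : CompleteSpace (LinearMap.ker T.toLinearMap) := hcl.completeSpace_coe
  have hM : Set.MapsTo T (LinearMap.ker T.toLinearMap) (LinearMap.ker T.toLinearMap) := by
    intro x hx
    have hx' : T x = 0 := hx
    change T (T x) = 0
    rw [hx', map_zero]
  refine hT.pure _ hM ?_ ?_
  · intro x hx
    change T (ContinuousLinearMap.adjoint T x) = 0
    rw [habs]
    have hx' : CFC.abs T x = 0 := (habs x).mp hx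
    refine ext_inner_left ℂ fun w => ?_
    have hc : T (CFC.abs T w) = CFC.abs T (T w) := congrArg (fun S => S w) hT.quasinormal
    rw [← inner_abs_left, ContinuousLinearMap.adjoint_inner_right, hc, inner_abs_left, hx',
      inner_zero_right, inner_zero_right]
  · have h0 : T.restrict hM = 0 := by
      ext x
      exact x.2
    rw [h0]
    exact ⟨Commute.zero_right _⟩

/-- The powers of `A_T` have dense range. -/
theorem denseRange_defectOp_pow (T : H →L[ℂ] H) (hT : IsPureQuasinormal T) (n : ℕ) :
    DenseRange (defectOp T hT ^ n) := by
  have hsa : ∀ x y : defectSpace T, ⟪defectOp T hT x, y⟫_ℂ = ⟪x, defectOp T hT y⟫_ℂ :=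
    fun x y => inner_abs_left T x y
  have h1 : DenseRange (defectOp T hT) := by
    have h2 : (LinearMap.range (defectOp T hT).toLinearMap).topologicalClosure = ⊤ := by
      rw [Submodule.topologicalClosure_eq_top_iff, Submodule.eq_bot_iff]
      intro x hx
      have h3 : defectOp T hT x = 0 := by
        refine ext_inner_left ℂ fun w => ?_
        rw [← hsa, inner_zero_right]
        exact (Submodule.mem_orthogonal _ _).mp hx _ (LinearMap.mem_range_self _ w)
      have h4 : CFC.abs T (x : H) = 0 := congrArg Subtype.val h3
      have h5 : (x : H) ∈ LinearMap.ker T.toLinearMap := by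
        change T (x : H) = 0
        rw [← norm_eq_zero, ← norm_abs_apply, h4, norm_zero]
      rw [ker_eq_bot T hT, Submodule.mem_bot] at h5
      exact Subtype.ext h5
    have h6 := congrArg (fun M : Submodule ℂ (defectSpace T) => (M : Set (defectSpace T))) h2
    simp only [Submodule.topologicalClosure_coe, Submodule.top_coe] at h6
    exact dense_iff_closure_eq.mpr h6
  induction n with
  | zero =>
    rw [pow_zero]
    exact fun x => subset_closure ⟨x, rfl⟩
  | succ k ih =>
    rw [pow_succ]
    exact ih.comp h1 (defectOp T hT ^ k).continuous

/-! ### The sets `𝒜_r(A, B)` -/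

/-- `𝒜_r(A, B)`: the operators `L` for which there is `c ≥ 0` with
`‖r⁻ⁿ Aⁿ L x‖ ≤ c ‖Bⁿ x‖` for all `x` and all `n`. -/
def deddens {H₁ H₂ : Type*} [NormedAddCommGroup H₁] [InnerProductSpace ℂ H₁]
    [NormedAddCommGroup H₂] [InnerProductSpace ℂ H₂]
    (r : ℝ) (A : H₁ →L[ℂ] H₁) (B : H₂ →L[ℂ] H₂) : Set (H₂ →L[ℂ] H₁) :=
  {L | ∃ c : ℝ, 0 ≤ c ∧ ∀ (x : H₂) (n : ℕ), ‖(r⁻¹ ^ n) • (A ^ n) (L x)‖ ≤ c * ‖(B ^ n) x‖}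

/-! ### Operators on `K ⊗ H²`, identified with the Hilbert sum of countably many copies of `K` -/

section Model

variable {K : Type u} [NormedAddCommGroup K] [InnerProductSpace ℂ K]

/-- The Hilbert space `K ⊗ H² = ⊕_{k ≥ 0} K` of square summable sequences in `K`. -/
abbrev HardyTensor (K : Type u) [NormedAddCommGroup K] : Type u :=
  lp (fun _ : ℕ => K) 2

/-- The sequence `(0, f 0, f 1, …)`. -/
def shiftFun (f : ℕ → K) : ℕ → K
  | 0 => 0
  | n + 1 => f n

theorem hasSum_shiftFun {K : Type u} [NormedAddCommGroup K] (f : HardyTensor K) :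
    HasSum (fun n => ‖shiftFun f n‖ ^ (2 : ℝ≥0∞).toReal) (‖f‖ ^ (2 : ℝ≥0∞).toReal) := by
  have h := lp.hasSum_norm (p := 2) (by norm_num) f
  rw [← hasSum_nat_add_iff' 1]
  simpa [shiftFun] using h

/-- `I ⊗ S`, the shift `(x₀, x₁, …) ↦ (0, x₀, x₁, …)`. -/
def shift (K : Type u) [NormedAddCommGroup K] [InnerProductSpace ℂ K] :
    HardyTensor K →L[ℂ] HardyTensor K :=
  LinearMap.mkContinuous
    { toFun := fun f => ⟨shiftFun f, memℓp_gen (hasSum_shiftFun f).summable⟩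
      map_add' := fun f g => by
        ext n
        cases n
        · exact (add_zero (0 : K)).symm
        · rfl
      map_smul' := fun c f => by
        ext n
        cases n <;> simp [shiftFun] }
    1 fun f => by
      rw [one_mul]
      refine lp.norm_le_of_tsum_le (by norm_num) (norm_nonneg _) ?_
      exact (hasSum_shiftFun f).tsum_eq.le

theorem summable_diag (X : ℕ → K →L[ℂ] K) {C : ℝ} (hX : ∀ n, ‖X n‖ ≤ C) (f : HardyTensor K) :
    Summable (fun n => ‖X n (f n)‖ ^ (2 : ℝ≥0∞).toReal) ∧
      ∑' n, ‖X n (f n)‖ ^ (2 : ℝ≥0∞).toReal ≤ (C * ‖f‖) ^ (2 : ℝ≥0∞).toReal := by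
  have hC : 0 ≤ C := (norm_nonneg _).trans (hX 0)
  have h := (lp.hasSum_norm (p := 2) (by norm_num) f).mul_left (C ^ (2 : ℝ≥0∞).toReal)
  have hle : ∀ n, ‖X n (f n)‖ ^ (2 : ℝ≥0∞).toReal ≤
      C ^ (2 : ℝ≥0∞).toReal * ‖f n‖ ^ (2 : ℝ≥0∞).toReal := fun n => by
    rw [← Real.mul_rpow hC (norm_nonneg _)]
    exact Real.rpow_le_rpow (norm_nonneg _) ((X n).le_of_opNorm_le (hX n) _) (by norm_num)
  have hs : Summable (fun n => ‖X n (f n)‖ ^ (2 : ℝ≥0∞).toReal) :=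
    h.summable.of_nonneg_of_le (fun n => by positivity) hle
  refine ⟨hs, ?_⟩
  rw [Real.mul_rpow hC (norm_nonneg _)]
  exact (hs.tsum_le_tsum hle h.summable).trans_eq h.tsum_eq

/-- `diag(X₀, X₁, …)` for a bounded sequence of operators. -/
def diag (X : ℕ → K →L[ℂ] K) (hX : ∃ C, ∀ n, ‖X n‖ ≤ C) :
    HardyTensor K →L[ℂ] HardyTensor K :=
  LinearMap.mkContinuous
    { toFun := fun f => ⟨fun n => X n (f n), memℓp_gen (summable_diag X hX.choose_spec f).1⟩
      map_add' := fun f g => by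
        ext n
        exact map_add (X n) (f n) (g n)
      map_smul' := fun c f => by
        ext n
        simp }
    hX.choose fun f =>
      lp.norm_le_of_tsum_le (by norm_num)
        (mul_nonneg ((norm_nonneg _).trans (hX.choose_spec 0)) (norm_nonneg _))
        (summable_diag X hX.choose_spec f).2

/-- `A ⊗ S = (A ⊗ I)(I ⊗ S)`. -/
def tensorShift (A : K →L[ℂ] K) : HardyTensor K →L[ℂ] HardyTensor K :=
  diag (fun _ => A) ⟨‖A‖, fun _ => le_rfl⟩ ∘L shift K

/-- The bounded extension to `K` of the map `Aⁿ x ↦ lam⁻ⁿ Aⁿ L x` on the range of `Aⁿ`. -/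
def diagEntry [CompleteSpace K] (A : K →L[ℂ] K) (lam : ℂ) (L : K →L[ℂ] K) (n : ℕ) : K →L[ℂ] K :=
  ((lam⁻¹ ^ n) • (A ^ n * L)).toLinearMap.extendOfNorm (A ^ n).toLinearMap

theorem diagEntry_bound {A : K →L[ℂ] K} {lam : ℂ} {L : K →L[ℂ] K} {c : ℝ}
    (hc : ∀ (x : K) (n : ℕ), ‖(‖lam‖⁻¹ ^ n) • (A ^ n) (L x)‖ ≤ c * ‖(A ^ n) x‖) (n : ℕ) (x : K) :
    ‖((lam⁻¹ ^ n) • (A ^ n * L)).toLinearMap x‖ ≤ c * ‖(A ^ n).toLinearMap x‖ := by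
  refine le_trans (le_of_eq ?_) (hc x n)
  change ‖(lam⁻¹ ^ n) • (A ^ n) (L x)‖ = _
  rw [norm_smul, norm_smul]
  simp

/-- `diagEntry` does extend `Aⁿ x ↦ lam⁻ⁿ Aⁿ L x`. -/
theorem diagEntry_apply [CompleteSpace K] {A : K →L[ℂ] K} (hA : ∀ n : ℕ, DenseRange (A ^ n : K →L[ℂ] K))
    {lam : ℂ} {L : K →L[ℂ] K} (hL : L ∈ deddens ‖lam‖ A A) (n : ℕ) (x : K) :
    diagEntry A lam L n ((A ^ n) x) = (lam⁻¹ ^ n) • (A ^ n) (L x) := by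
  obtain ⟨c, -, hc⟩ := hL
  exact LinearMap.extendOfNorm_eq (hA n) ⟨c, diagEntry_bound hc n⟩ x

theorem diagEntry_bounded [CompleteSpace K] {A : K →L[ℂ] K} (hA : ∀ n : ℕ, DenseRange (A ^ n : K →L[ℂ] K))
    {lam : ℂ} {L : K →L[ℂ] K} (hL : L ∈ deddens ‖lam‖ A A) :
    ∃ C, ∀ n, ‖diagEntry A lam L n‖ ≤ C := by
  obtain ⟨c, hc0, hc⟩ := hL
  exact ⟨c, fun n => LinearMap.opNorm_extendOfNorm_le (hA n) hc0 (diagEntry_bound hc n)⟩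

end Model

/-! ### The model unitary and the generators -/

/-- `U` is a unitary from `H` onto `𝔏_T ⊗ H²` with `U T U* = A_T ⊗ S`. -/
def IsModelUnitary (T : H →L[ℂ] H) (hT : IsPureQuasinormal T)
    (U : H ≃ₗᵢ[ℂ] HardyTensor (defectSpace T)) : Prop :=
  ∀ f, U (T (U.symm f)) = tensorShift (defectOp T hT) f

/-- `diag(L, X₁₁, X₂₂, …)` on `𝔏_T ⊗ H²`, where `Xₙₙ` is the bounded extension of
`A_Tⁿ x ↦ lam⁻ⁿ A_Tⁿ L x`; the entry of index `0` is `L` itself. -/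
def diagOp (T : H →L[ℂ] H) (hT : IsPureQuasinormal T) (lam : ℂ)
    (L : defectSpace T →L[ℂ] defectSpace T)
    (hL : L ∈ deddens ‖lam‖ (defectOp T hT) (defectOp T hT)) :
    HardyTensor (defectSpace T) →L[ℂ] HardyTensor (defectSpace T) :=
  diag (diagEntry (defectOp T hT) lam L)
    (diagEntry_bounded (denseRange_defectOp_pow T hT) hL)

/-- The operators `U* (I ⊗ Sᵐ) diag(L, X₁₁, X₂₂, …) U` with `m ∈ ℕ` and `L ∈ 𝒜_{|lam|}(A_T)`. -/
def generators (T : H →L[ℂ] H) (hT : IsPureQuasinormal T) (lam : ℂ)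
    (U : H ≃ₗᵢ[ℂ] HardyTensor (defectSpace T)) : Set (H →L[ℂ] H) :=
  {Y | ∃ (m : ℕ) (L : defectSpace T →L[ℂ] defectSpace T)
      (hL : L ∈ deddens ‖lam‖ (defectOp T hT) (defectOp T hT)),
      Y = (U.symm.toContinuousLinearEquiv : HardyTensor (defectSpace T) →L[ℂ] H) ∘L
        ((shift (defectSpace T) ^ m) ∘L diagOp T hT lam L hL) ∘L
          (U.toContinuousLinearEquiv : H →L[ℂ] HardyTensor (defectSpace T))}

end ExtEig

end

noncomputable section

namespace ExtEig

universe u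

variable {H : Type u} [NormedAddCommGroup H] [InnerProductSpace ℂ H] [CompleteSpace H]

/-! ### The Wold decomposition of a pure quasinormal operator -/

/-! Purity makes `T` injective, so `V = V_T` is an isometry, and quasinormality makes it commute
with `|T|`. The unitary part of its Wold decomposition reduces `T` to a normal operator and so
vanishes (`orthogonal_woldEmbedding_eq_bot`); what remains is `A ⊗ S` on the sum of the spaces `Vⁿ
𝔏_T`.

In this model, intertwining means `Y_{i+1,j+1} A = λ⁻¹ A Y_{i,j}` for the matrix entries, together
with `Y_{0,j+1} A = 0`. Since `A` has dense range, `Y` is lower triangular and its `m`-th diagonal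
is determined by the top entry `L = Y_{m,0}`. The bound `‖Y_{m+n,n}‖ ≤ ‖Y‖` puts `L` in
`𝒜_{|λ|}(A)`, so each diagonal is itself a generator (`entry_mem_deddens`, `diagEntry_entry`).

Partial sums of the diagonals need not be bounded, so Fejér means replace them: their norms are at
most `‖Y‖` (`norm_fejer_le`) and they converge to `Y` coordinatewise, hence weak*
(`tendsto_weakStar_of_bounded`). Conversely, the generators satisfy the intertwining relation, which
is linear and weak* closed (`isClosed_weakStar_setOf_intertwining`). -/

theorem denseRange_abs {T : H →L[ℂ] H} (hT : IsPureQuasinormal T) :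
    DenseRange (CFC.abs T : H →L[ℂ] H) := by
  have h : (LinearMap.range (CFC.abs T).toLinearMap).topologicalClosure = ⊤ := by
    rw [Submodule.topologicalClosure_eq_top_iff, Submodule.eq_bot_iff]
    intro x hx
    have h0 : CFC.abs T x = 0 := by
      refine ext_inner_left ℂ fun w => ?_
      rw [← inner_abs_left, inner_zero_right]
      exact (Submodule.mem_orthogonal _ _).mp hx _ (LinearMap.mem_range_self _ w)
    have h1 : x ∈ LinearMap.ker T.toLinearMap := by
      change T x = 0
      rw [← norm_eq_zero, ← norm_abs_apply, h0, norm_zero]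
    rwa [ker_eq_bot T hT, Submodule.mem_bot] at h1
  have hd := congrArg (fun M : Submodule ℂ H => (M : Set H)) h
  simp only [Submodule.topologicalClosure_coe, Submodule.top_coe] at hd
  exact dense_iff_closure_eq.mpr hd

/-- The factor `V_T` of a pure quasinormal operator is an isometry. -/
theorem norm_polarIsometry {T : H →L[ℂ] H} (hT : IsPureQuasinormal T) (x : H) :
    ‖polarIsometry T x‖ = ‖x‖ := by
  refine (denseRange_abs hT).induction_on (p := fun x => ‖polarIsometry T x‖ = ‖x‖) x
    (isClosed_eq (by fun_prop) (by fun_prop)) fun z => ?_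
  rw [polarIsometry_abs, norm_abs_apply]

theorem inner_polarIsometry {T : H →L[ℂ] H} (hT : IsPureQuasinormal T) (x y : H) :
    ⟪polarIsometry T x, polarIsometry T y⟫_ℂ = ⟪x, y⟫_ℂ :=
  LinearIsometry.inner_map_map
    (⟨(polarIsometry T).toLinearMap, norm_polarIsometry hT⟩ : H →ₗᵢ[ℂ] H) x y

theorem inner_polarIsometry_pow {T : H →L[ℂ] H} (hT : IsPureQuasinormal T) (n : ℕ) (x y : H) :
    ⟪(polarIsometry T ^ n) x, (polarIsometry T ^ n) y⟫_ℂ = ⟪x, y⟫_ℂ := by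
  induction n with
  | zero => rfl
  | succ k ih =>
    rw [pow_succ', mul_apply_eq_comp, mul_apply_eq_comp, inner_polarIsometry hT, ih]

theorem inner_polarIsometry_of_mem_defectSpace {T : H →L[ℂ] H} {x : H} (hx : x ∈ defectSpace T)
    (z : H) : ⟪polarIsometry T z, x⟫_ℂ = 0 :=
  (Submodule.mem_orthogonal _ _).mp hx _ (LinearMap.mem_range_self _ z)

theorem abs_polarIsometry_pow {T : H →L[ℂ] H} (hT : IsQuasinormal T) (n : ℕ) (x : H) :
    CFC.abs T ((polarIsometry T ^ n) x) = (polarIsometry T ^ n) (CFC.abs T x) := by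
  induction n with
  | zero => rfl
  | succ k ih =>
    rw [pow_succ', mul_apply_eq_comp, mul_apply_eq_comp, ← polarIsometry_commute T hT, ih]

/-- The embedding `x ↦ V_Tⁿ x` of `𝔏_T` into `H`. -/
def woldEmbedding {T : H →L[ℂ] H} (hT : IsPureQuasinormal T) (n : ℕ) :
    defectSpace T →ₗᵢ[ℂ] H where
  toLinearMap := (polarIsometry T ^ n).toLinearMap ∘ₗ (defectSpace T).subtype
  norm_map' x := by
    have h := inner_polarIsometry_pow hT n (x : H) x
    rw [inner_self_eq_norm_sq_to_K, inner_self_eq_norm_sq_to_K] at h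
    have h2 : ‖(polarIsometry T ^ n) (x : H)‖ ^ 2 = ‖(x : H)‖ ^ 2 := by exact_mod_cast h
    exact (sq_eq_sq₀ (norm_nonneg _) (norm_nonneg _)).mp h2

theorem woldEmbedding_apply {T : H →L[ℂ] H} (hT : IsPureQuasinormal T) (n : ℕ)
    (x : defectSpace T) : woldEmbedding hT n x = (polarIsometry T ^ n) (x : H) :=
  rfl

/-- Cancelling the common power of the isometry leaves a vector in the range of `V_T` against a
vector of `𝔏_T`. -/
theorem orthogonalFamily_woldEmbedding {T : H →L[ℂ] H} (hT : IsPureQuasinormal T) :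
    OrthogonalFamily ℂ (fun _ : ℕ => defectSpace T) (woldEmbedding hT) := by
  have key : ∀ (m k : ℕ) (x y : defectSpace T),
      ⟪woldEmbedding hT (m + k + 1) x, woldEmbedding hT m y⟫_ℂ = 0 := fun m k x y => by
    rw [woldEmbedding_apply, woldEmbedding_apply, add_assoc, pow_add, mul_apply_eq_comp,
      inner_polarIsometry_pow hT, pow_succ', mul_apply_eq_comp]
    exact inner_polarIsometry_of_mem_defectSpace y.2 _
  intro i j hij x y
  rcases lt_or_gt_of_ne hij with h | h
  · obtain ⟨k, rfl⟩ := Nat.exists_eq_add_of_lt h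
    rw [inner_eq_zero_symm]
    exact key _ _ _ _
  · obtain ⟨k, rfl⟩ := Nat.exists_eq_add_of_lt h
    exact key _ _ _ _

theorem mem_orthogonal_woldEmbedding {T : H →L[ℂ] H} (hT : IsPureQuasinormal T) {x : H} :
    x ∈ (⨆ n, LinearMap.range (woldEmbedding hT n).toLinearMap)ᗮ ↔
      ∀ (n : ℕ) (y : H), y ∈ defectSpace T → ⟪(polarIsometry T ^ n) y, x⟫_ℂ = 0 := by
  rw [← Submodule.iInf_orthogonal, Submodule.mem_iInf]
  refine forall_congr' fun n => ?_
  rw [Submodule.mem_orthogonal]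
  constructor
  · intro h y hy
    exact h _ ⟨⟨y, hy⟩, rfl⟩
  · rintro h _ ⟨y, rfl⟩
    exact h y y.2

/-- The unitary part of the Wold decomposition of `V_T` reduces `T` to a normal operator, hence
vanishes. -/
theorem orthogonal_woldEmbedding_eq_bot {T : H →L[ℂ] H} (hT : IsPureQuasinormal T) :
    (⨆ n, LinearMap.range (woldEmbedding hT n).toLinearMap)ᗮ = ⊥ := by
  let M := (⨆ n, LinearMap.range (woldEmbedding hT n).toLinearMap)ᗮ
  have mem : ∀ {x : H}, x ∈ M ↔
      ∀ (n : ℕ) (y : H), y ∈ defectSpace T → ⟪(polarIsometry T ^ n) y, x⟫_ℂ = 0 :=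
    mem_orthogonal_woldEmbedding hT
  have : CompleteSpace M := (Submodule.isClosed_orthogonal _).completeSpace_coe
  have hV : ∀ x ∈ M, polarIsometry T x ∈ M := fun x hx => mem.mpr fun n y hy => by
    cases n with
    | zero =>
      rw [inner_eq_zero_symm]
      exact inner_polarIsometry_of_mem_defectSpace hy x
    | succ n =>
      rw [pow_succ', mul_apply_eq_comp, inner_polarIsometry hT]
      exact mem.mp hx n y hy
  have hVs : ∀ x ∈ M, ContinuousLinearMap.adjoint (polarIsometry T) x ∈ M := fun x hx =>
    mem.mpr fun n y hy => by
      rw [ContinuousLinearMap.adjoint_inner_right, ← mul_apply_eq_comp, ← pow_succ']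
      exact mem.mp hx (n + 1) y hy
  have hA : ∀ x ∈ M, CFC.abs T x ∈ M := fun x hx => mem.mpr fun n y hy => by
    rw [← inner_abs_left, abs_polarIsometry_pow hT.quasinormal]
    exact mem.mp hx n _ (abs_mapsTo_defectSpace T hT.quasinormal hy)
  have hTadj : ∀ x, ContinuousLinearMap.adjoint T x =
      CFC.abs T (ContinuousLinearMap.adjoint (polarIsometry T) x) := fun x => by
    refine ext_inner_left ℂ fun w => ?_
    rw [ContinuousLinearMap.adjoint_inner_right, ← inner_abs_left,
      ContinuousLinearMap.adjoint_inner_right, polarIsometry_abs]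
  have hTM : Set.MapsTo T M M := fun x hx => by
    rw [← polarIsometry_abs]
    exact hV _ (hA _ hx)
  have hTsM : Set.MapsTo (ContinuousLinearMap.adjoint T) M M := fun x hx => by
    rw [hTadj]
    exact hA _ (hVs _ hx)
  -- `V V* = 1` on `M`: the vector `x - V V* x` lies in both `𝔏_T` and `M`, and the case `n = 0` of
  -- `mem` makes it orthogonal to itself.
  have hVV : ∀ x ∈ M, polarIsometry T (ContinuousLinearMap.adjoint (polarIsometry T) x) = x := by
    intro x hx
    have hd : x - polarIsometry T (ContinuousLinearMap.adjoint (polarIsometry T) x) ∈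
        defectSpace T := by
      refine (Submodule.mem_orthogonal _ _).mpr ?_
      rintro _ ⟨z, rfl⟩
      change ⟪polarIsometry T z, _⟫_ℂ = 0
      rw [inner_sub_right, inner_polarIsometry hT, ContinuousLinearMap.adjoint_inner_right, sub_self]
    have hm := M.sub_mem hx (hV _ (hVs _ hx))
    have h0 := mem.mp hm 0 _ hd
    exact (sub_eq_zero.mp (inner_self_eq_zero.mp h0)).symm
  refine hT.pure M hTM hTsM ⟨?_⟩
  have hadj : star (T.restrict hTM) = (ContinuousLinearMap.adjoint T).restrict hTsM := by
    rw [ContinuousLinearMap.star_eq_adjoint]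
    refine ((ContinuousLinearMap.eq_adjoint_iff _ _).mpr fun x y => ?_).symm
    exact ContinuousLinearMap.adjoint_inner_left T (y : H) (x : H)
  rw [hadj]
  refine ContinuousLinearMap.ext fun x => Subtype.ext ?_
  change ContinuousLinearMap.adjoint T (T x) = T (ContinuousLinearMap.adjoint T x)
  have h1 : ContinuousLinearMap.adjoint T (T x) = CFC.abs T (CFC.abs T x) := by
    have h := congrArg (fun S : H →L[ℂ] H => S x) (CFC.abs_mul_abs T)
    exact h.symm
  -- `T T* = V |T| |T| V* = |T|² V V*`, which on `M` is `|T|² = T* T`.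
  rw [h1, hTadj, ← polarIsometry_abs T, polarIsometry_commute T hT.quasinormal,
    polarIsometry_commute T hT.quasinormal, hVV x x.2]

theorem isHilbertSum_woldEmbedding {T : H →L[ℂ] H} (hT : IsPureQuasinormal T) :
    IsHilbertSum ℂ (fun _ : ℕ => defectSpace T) (woldEmbedding hT) :=
  IsHilbertSum.mk (orthogonalFamily_woldEmbedding hT)
    (Submodule.topologicalClosure_eq_top_iff.mpr (orthogonal_woldEmbedding_eq_bot hT)).ge

/-! ### Coordinates in `K ⊗ H²` -/

section Model

variable {K : Type u} [NormedAddCommGroup K] [InnerProductSpace ℂ K]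

@[simp]
theorem shift_apply_zero (f : HardyTensor K) : shift K f 0 = 0 :=
  rfl

@[simp]
theorem shift_apply_succ (f : HardyTensor K) (n : ℕ) : shift K f (n + 1) = f n :=
  rfl

@[simp]
theorem diag_apply (X : ℕ → K →L[ℂ] K) (hX : ∃ C, ∀ n, ‖X n‖ ≤ C) (f : HardyTensor K) (n : ℕ) :
    diag X hX f n = X n (f n) :=
  rfl

@[simp]
theorem tensorShift_apply_zero (A : K →L[ℂ] K) (f : HardyTensor K) : tensorShift A f 0 = 0 :=
  map_zero A

@[simp]
theorem tensorShift_apply_succ (A : K →L[ℂ] K) (f : HardyTensor K) (n : ℕ) :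
    tensorShift A f (n + 1) = A (f n) :=
  rfl

theorem shift_pow_apply (m : ℕ) (f : HardyTensor K) (i : ℕ) :
    (shift K ^ m) f i = if m ≤ i then f (i - m) else 0 := by
  induction m generalizing i with
  | zero => simp
  | succ m ih =>
    rw [pow_succ', mul_apply_eq_comp]
    cases i with
    | zero => simp
    | succ i =>
      rw [shift_apply_succ, ih]
      simp

end Model

/-- Every pure quasinormal operator is unitarily equivalent to `A_T ⊗ S`. -/
theorem exists_isModelUnitary {T : H →L[ℂ] H} (hT : IsPureQuasinormal T) :
    ∃ U : H ≃ₗᵢ[ℂ] HardyTensor (defectSpace T), IsModelUnitary T hT U := by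
  have hs := isHilbertSum_woldEmbedding hT
  refine ⟨hs.linearIsometryEquiv, fun f => ?_⟩
  rw [← LinearIsometryEquiv.eq_symm_apply]
  have h1 := (hs.hasSum_linearIsometryEquiv_symm f).mapL T
  have h2 := hs.hasSum_linearIsometryEquiv_symm (tensorShift (defectOp T hT) f)
  -- The zeroth term vanishes; without it the series match term by term, as `T Vⁿ x = Vⁿ⁺¹ |T| x`.
  rw [← hasSum_nat_add_iff' 1] at h2
  simp only [Finset.sum_range_one, tensorShift_apply_zero, map_zero, sub_zero,
    tensorShift_apply_succ] at h2
  refine h1.unique ?_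
  convert h2 using 2 with n
  rw [woldEmbedding_apply, woldEmbedding_apply, ← polarIsometry_abs,
    abs_polarIsometry_pow hT.quasinormal, pow_succ', mul_apply_eq_comp]
  rfl

/-! ### Convergence and closedness in the weak* topology -/

section WeakStar

open Filter Topology

/-- This is the defining functional for two sequences supported at index `0`. -/
theorem continuous_weakStar_inner {H : Type u} [NormedAddCommGroup H] [InnerProductSpace ℂ H]
    (x y : H) : @Continuous _ _ (weakStarTopology H) _ fun X : H →L[ℂ] H => ⟪y, X x⟫_ℂ := by
  have h : Continuous[weakStarTopology H, _] fun X : H →L[ℂ] H =>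
      ∑' n, ⟪(lp.single 2 0 y : lp (fun _ : ℕ => H) 2) n,
        X ((lp.single 2 0 x : lp (fun _ : ℕ => H) 2) n)⟫_ℂ :=
    continuous_iff_le_induced.mpr (iInf₂_le _ _)
  convert h using 2 with X
  rw [tsum_eq_single 0 fun n hn => by rw [lp.single_apply_ne _ _ _ hn, inner_zero_left],
    lp.single_apply_self, lp.single_apply_self]

/-- Moving `T` across the inner product as its adjoint turns the relation into equalities between
functionals `X ↦ ⟪y, X x⟫`, all weak* continuous. -/
theorem isClosed_weakStar_setOf_intertwining (T : H →L[ℂ] H) (lam : ℂ) :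
    @IsClosed _ (weakStarTopology H) {X : H →L[ℂ] H | T ∘L X = lam • (X ∘L T)} := by
  let := weakStarTopology H
  have h : {X : H →L[ℂ] H | T ∘L X = lam • (X ∘L T)} =
      ⋂ (x : H) (y : H), {X : H →L[ℂ] H |
        ⟪ContinuousLinearMap.adjoint T y, X x⟫_ℂ = lam * ⟪y, X (T x)⟫_ℂ} := by
    ext X
    simp only [Set.mem_iInter, Set.mem_ofPred_eq, ContinuousLinearMap.adjoint_inner_left,
      ← inner_smul_right]
    constructor
    · intro h x y
      exact congrArg (fun Z : H →L[ℂ] H => ⟪y, Z x⟫_ℂ) h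
    · intro h
      exact ContinuousLinearMap.ext fun x => ext_inner_left ℂ fun y => h x y
  rw [h]
  refine isClosed_iInter fun x => isClosed_iInter fun y => isClosed_eq ?_ ?_
  · exact continuous_weakStar_inner _ _
  · exact continuous_const.mul (continuous_weakStar_inner _ _)

/-- A bounded sequence of operators that converges in the weak operator topology converges in the
weak* topology. -/
theorem tendsto_weakStar_of_bounded {H : Type u} [NormedAddCommGroup H] [InnerProductSpace ℂ H]
    {X : ℕ → H →L[ℂ] H} {Y : H →L[ℂ] H} {C : ℝ} (hC : ∀ N, ‖X N‖ ≤ C)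
    (h : ∀ x y : H, Tendsto (fun N => ⟪y, X N x⟫_ℂ) atTop (𝓝 ⟪y, Y x⟫_ℂ)) :
    Tendsto X atTop (@nhds _ (weakStarTopology H) Y) := by
  simp only [nhds_iInf, tendsto_iInf, nhds_induced, tendsto_comap_iff]
  intro x y
  have hs : Summable fun n => C * (‖x n‖ * ‖y n‖) :=
    (lp.summable_mul (by rw [Real.holderConjugate_iff]; norm_num) x y).mul_left C
  refine tendsto_tsum_of_dominated_convergence hs (fun n => h (x n) (y n))
    (Eventually.of_forall fun N n => ?_)
  calc ‖⟪y n, X N (x n)⟫_ℂ‖ ≤ ‖y n‖ * ‖X N (x n)‖ := norm_inner_le_norm _ _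
    _ ≤ ‖y n‖ * (C * ‖x n‖) := by gcongr; exact (X N).le_of_opNorm_le (hC N) _
    _ = C * (‖x n‖ * ‖y n‖) := by ring

/-- A bounded sequence in `K ⊗ H²` that converges coordinatewise converges weakly. -/
theorem tendsto_inner_of_tendsto_coord {K : Type u} [NormedAddCommGroup K] [InnerProductSpace ℂ K]
    {h : ℕ → HardyTensor K} {h₀ : HardyTensor K} {C : ℝ} (hC : ∀ N, ‖h N‖ ≤ C)
    (hh : ∀ i, Tendsto (fun N => h N i) atTop (𝓝 (h₀ i))) (g : HardyTensor K) :
    Tendsto (fun N => ⟪g, h N⟫_ℂ) atTop (𝓝 ⟪g, h₀⟫_ℂ) := by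
  -- The bound `C` makes these functionals equicontinuous, so the set of `g` for which convergence
  -- holds is closed. It then suffices to treat finitely supported `g`, where only finitely many
  -- coordinates enter.
  have hequi : Equicontinuous fun (N : ℕ) (g : HardyTensor K) => ⟪g, h N⟫_ℂ := by
    refine (Metric.uniformEquicontinuous_of_continuity_modulus (fun t => t * C) ?_ _ ?_).equicontinuous
    · have : Tendsto (fun t : ℝ => t * C) (𝓝 0) (𝓝 (0 * C)) := tendsto_id.mul_const C
      rwa [zero_mul] at this
    · intro f g N
      rw [dist_eq_norm, dist_eq_norm, ← inner_sub_left]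
      refine (norm_inner_le_norm _ _).trans ?_
      gcongr
      exact hC N
  have hcl := hequi.isClosed_setOfPred_tendsto (l := atTop)
    (show Continuous fun g : HardyTensor K => ⟪g, h₀⟫_ℂ by fun_prop)
  refine hcl.mem_of_tendsto (lp.hasSum_single (by norm_num) g) (Eventually.of_forall fun s => ?_)
  simp only [Set.mem_ofPred_eq, sum_inner, lp.inner_single_left]
  exact tendsto_finsetSum _ fun i _ => tendsto_const_nhds.inner (hh i)

end WeakStar

/-! ### Matrix entries of operators on `K ⊗ H²` -/

section Entries

variable {K : Type u} [NormedAddCommGroup K] [InnerProductSpace ℂ K]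

theorem sum_sq_norm_le {K : Type u} [NormedAddCommGroup K]
    (f : HardyTensor K) (s : Finset ℕ) : ∑ i ∈ s, ‖f i‖ ^ 2 ≤ ‖f‖ ^ 2 := by
  have h := lp.sum_rpow_le_norm_rpow (p := 2) (by norm_num) f s
  simpa using h

theorem norm_le_of_sum_sq_norm_le {K : Type u} [NormedAddCommGroup K]
    {f : HardyTensor K} {C : ℝ} (hC : 0 ≤ C)
    (h : ∀ s : Finset ℕ, ∑ i ∈ s, ‖f i‖ ^ 2 ≤ C ^ 2) : ‖f‖ ≤ C := by
  refine lp.norm_le_of_forall_sum_le (p := 2) (by norm_num) hC fun s => ?_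
  simpa using h s

/-- The matrix entry of index `(i, j)` of an operator on `⊕ K`. -/
def entry (Y : HardyTensor K →L[ℂ] HardyTensor K) (i j : ℕ) : K →L[ℂ] K :=
  lp.evalCLM ℂ (fun _ : ℕ => K) 2 i ∘L Y ∘L lp.singleContinuousLinearMap ℂ (fun _ : ℕ => K) 2 j

theorem entry_apply (Y : HardyTensor K →L[ℂ] HardyTensor K) (i j : ℕ) (x : K) :
    entry Y i j x = Y (lp.single 2 j x) i :=
  rfl

theorem norm_entry_apply_le (Y : HardyTensor K →L[ℂ] HardyTensor K) (i j : ℕ) (x : K) :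
    ‖entry Y i j x‖ ≤ ‖Y‖ * ‖x‖ := by
  rw [entry_apply]
  refine (lp.norm_apply_le_norm (by norm_num) _ i).trans ?_
  refine (Y.le_opNorm _).trans_eq ?_
  rw [lp.norm_single (by norm_num)]

/-- The coordinates of the image under an operator with lower triangular matrix. -/
theorem apply_eq_sum_entry {Y : HardyTensor K →L[ℂ] HardyTensor K}
    (hY : ∀ i j, i < j → entry Y i j = 0) (f : HardyTensor K) (i : ℕ) :
    Y f i = ∑ m ∈ Finset.range (i + 1), entry Y i (i - m) (f (i - m)) := by
  have h1 : HasSum (fun j => entry Y i j (f j)) (Y f i) :=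
    (lp.hasSum_single (by norm_num) f).mapL (lp.evalCLM ℂ (fun _ : ℕ => K) 2 i ∘L Y)
  have h2 : HasSum (fun j => entry Y i j (f j)) (∑ j ∈ Finset.range (i + 1), entry Y i j (f j)) :=
    hasSum_sum_of_ne_finset_zero fun j hj => by
      rw [hY i j (by simpa [Nat.lt_succ_iff] using hj)]
      rfl
  rw [h1.unique h2, ← Finset.sum_range_reflect]
  rfl

/-- The restriction of a sequence to the window of indices `(k - N, k]`. -/
def window (N k : ℕ) : HardyTensor K →L[ℂ] HardyTensor K :=
  diag (fun j => if j ≤ k ∧ k < j + N then ContinuousLinearMap.id ℂ K else 0)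
    ⟨1, fun j => by
      split_ifs
      · exact ContinuousLinearMap.norm_id_le
      · simp⟩

theorem window_apply (N k : ℕ) (f : HardyTensor K) (j : ℕ) :
    window N k f j = if j ≤ k ∧ k < j + N then f j else 0 := by
  rw [window, diag_apply]
  split_ifs <;> rfl

/-- Each index lies in exactly `N` windows, so exchanging the two sums counts each `‖f j‖ ^ 2` at
most `N` times. For `k < M` the window ends before `M`, which makes both sums finite. -/
theorem sum_sq_norm_window_le (N M : ℕ) (f : HardyTensor K) :
    ∑ k ∈ Finset.range M, ‖window N k f‖ ^ 2 ≤ N * ‖f‖ ^ 2 := by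
  have h1 : ∀ k ∈ Finset.range M, ‖window N k f‖ ^ 2 ≤
      ∑ j ∈ Finset.range M, ‖window N k f j‖ ^ 2 := by
    intro k hk
    have hnn : 0 ≤ ∑ j ∈ Finset.range M, ‖window N k f j‖ ^ 2 :=
      Finset.sum_nonneg fun _ _ => by positivity
    rw [← Real.sq_sqrt hnn]
    gcongr
    refine norm_le_of_sum_sq_norm_le (Real.sqrt_nonneg _) fun s => ?_
    rw [Real.sq_sqrt hnn]
    refine (Finset.sum_le_sum_of_subset_of_nonneg Finset.subset_union_left
      (t := s ∪ Finset.range M) fun _ _ _ => by positivity).trans_eq ?_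
    refine (Finset.sum_subset Finset.subset_union_right fun j _ hj => ?_).symm
    rw [window_apply, if_neg, norm_zero, zero_pow two_ne_zero]
    simp only [Finset.mem_range] at hk hj
    omega
  have h2 : ∀ j, ∑ k ∈ Finset.range M, ‖window N k f j‖ ^ 2 ≤ N * ‖f j‖ ^ 2 := by
    intro j
    have h3 : ∀ k, ‖window N k f j‖ ^ 2 = if k ∈ Finset.Ico j (j + N) then ‖f j‖ ^ 2 else 0 := by
      intro k
      rw [window_apply]
      simp only [Finset.mem_Ico]
      split_ifs <;> simp
    simp only [h3]
    rw [← Finset.sum_filter, Finset.sum_const, nsmul_eq_mul]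
    gcongr
    calc (Finset.filter (· ∈ Finset.Ico j (j + N)) (Finset.range M)).card
        ≤ (Finset.Ico j (j + N)).card :=
          Finset.card_le_card fun k hk => (Finset.mem_filter.mp hk).2
      _ = N := by simp
  calc ∑ k ∈ Finset.range M, ‖window N k f‖ ^ 2
      ≤ ∑ k ∈ Finset.range M, ∑ j ∈ Finset.range M, ‖window N k f j‖ ^ 2 := Finset.sum_le_sum h1
    _ = ∑ j ∈ Finset.range M, ∑ k ∈ Finset.range M, ‖window N k f j‖ ^ 2 := Finset.sum_comm
    _ ≤ ∑ j ∈ Finset.range M, N * ‖f j‖ ^ 2 := Finset.sum_le_sum fun j _ => h2 j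
    _ = N * ∑ j ∈ Finset.range M, ‖f j‖ ^ 2 := (Finset.mul_sum _ _ _).symm
    _ ≤ N * ‖f‖ ^ 2 := by gcongr; exact sum_sq_norm_le f _

/-- The contributions of the first diagonals to coordinate `i`, weighted as in the Fejér mean of
order `N`, are the sum of those of the compressions of the operator to windows of length `N`. -/
theorem sum_window_eq {Y : HardyTensor K →L[ℂ] HardyTensor K}
    (hY : ∀ i j, i < j → entry Y i j = 0) (N : ℕ) (f : HardyTensor K) (i : ℕ) :
    ∑ k ∈ Finset.Ico i (i + N), Y (window N k f) i =
      ∑ m ∈ Finset.range N,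
        (N - m) • if m ≤ i then entry Y i (i - m) (f (i - m)) else 0 := by
  rw [Finset.sum_Ico_eq_sum_range, Nat.add_sub_cancel_left]
  -- For `m ≤ i`, the index `i - m` lies in the window ending at `i + s` exactly when `s < N - m`;
  -- hence diagonal `m` is counted `N - m` times.
  have h1 : ∀ s, Y (window N (i + s) f) i = ∑ m ∈ Finset.range N,
      if s < N - m then (if m ≤ i then entry Y i (i - m) (f (i - m)) else 0) else 0 := by
    intro s
    rw [apply_eq_sum_entry hY, ← Finset.sum_filter, ← Finset.sum_filter, Finset.filter_filter]
    symm
    refine Finset.sum_subset_zero_on_sdiff ?_ ?_ ?_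
    · intro m hm
      simp only [Finset.mem_filter, Finset.mem_range] at hm ⊢
      omega
    · intro m hm
      simp only [Finset.mem_sdiff, Finset.mem_filter, Finset.mem_range] at hm
      rw [window_apply, if_neg (by omega), map_zero]
    · intro m hm
      simp only [Finset.mem_filter, Finset.mem_range] at hm
      rw [window_apply, if_pos (by omega)]
  simp only [h1]
  rw [Finset.sum_comm]
  refine Finset.sum_congr rfl fun m _ => ?_
  rw [← Finset.sum_filter, Finset.sum_const]
  congr 1
  have : Finset.filter (fun s => s < N - m) (Finset.range N) = Finset.range (N - m) := by
    ext s
    simp only [Finset.mem_filter, Finset.mem_range]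
    omega
  rw [this, Finset.card_range]

/-- Fejér means of a lower triangular operator do not increase the norm. -/
theorem norm_fejer_le {Y : HardyTensor K →L[ℂ] HardyTensor K}
    (hY : ∀ i j, i < j → entry Y i j = 0) {N : ℕ} (hN : N ≠ 0) {f g : HardyTensor K}
    (hg : ∀ i, (N : ℂ) • g i = ∑ m ∈ Finset.range N,
      (N - m) • if m ≤ i then entry Y i (i - m) (f (i - m)) else 0) :
    ‖g‖ ≤ ‖Y‖ * ‖f‖ := by
  refine norm_le_of_sum_sq_norm_le (by positivity) fun s => ?_
  obtain ⟨n, hn⟩ : ∃ n, s ⊆ Finset.range n := ⟨_, s.subset_range_sup_succ⟩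
  -- Cauchy–Schwarz over the `N` windows containing `i`. The sum is then enlarged to `k < n + N`, a
  -- range independent of `i`, so that the sums over `i` and `k` can be exchanged.
  have h1 : ∀ i ∈ s, (N : ℝ) ^ 2 * ‖g i‖ ^ 2 ≤
      N * ∑ k ∈ Finset.range (n + N), ‖Y (window N k f) i‖ ^ 2 := by
    intro i hi
    have hin : i < n := Finset.mem_range.mp (hn hi)
    have h2 : (N : ℝ) * ‖g i‖ ≤ ∑ k ∈ Finset.Ico i (i + N), ‖Y (window N k f) i‖ := by
      have : (N : ℝ) * ‖g i‖ = ‖(N : ℂ) • g i‖ := by rw [norm_smul]; simp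
      rw [this, hg, ← sum_window_eq hY]
      exact norm_sum_le _ _
    calc (N : ℝ) ^ 2 * ‖g i‖ ^ 2 = (N * ‖g i‖) ^ 2 := by ring
      _ ≤ (∑ k ∈ Finset.Ico i (i + N), ‖Y (window N k f) i‖) ^ 2 := by gcongr
      _ ≤ (Finset.Ico i (i + N)).card *
          ∑ k ∈ Finset.Ico i (i + N), ‖Y (window N k f) i‖ ^ 2 := sq_sum_le_card_mul_sum_sq
      _ = N * ∑ k ∈ Finset.Ico i (i + N), ‖Y (window N k f) i‖ ^ 2 := by simp
      _ ≤ N * ∑ k ∈ Finset.range (n + N), ‖Y (window N k f) i‖ ^ 2 := by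
        gcongr
        intro k hk
        simp only [Finset.mem_Ico, Finset.mem_range] at hk ⊢
        omega
  have h3 : (N : ℝ) ^ 2 * ∑ i ∈ s, ‖g i‖ ^ 2 ≤ N ^ 2 * (‖Y‖ * ‖f‖) ^ 2 := by
    calc (N : ℝ) ^ 2 * ∑ i ∈ s, ‖g i‖ ^ 2 = ∑ i ∈ s, (N : ℝ) ^ 2 * ‖g i‖ ^ 2 := Finset.mul_sum _ _ _
      _ ≤ ∑ i ∈ s, N * ∑ k ∈ Finset.range (n + N), ‖Y (window N k f) i‖ ^ 2 :=
        Finset.sum_le_sum h1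
      _ = N * ∑ k ∈ Finset.range (n + N), ∑ i ∈ s, ‖Y (window N k f) i‖ ^ 2 := by
        rw [← Finset.mul_sum, Finset.sum_comm]
      _ ≤ N * ∑ k ∈ Finset.range (n + N), ‖Y‖ ^ 2 * ‖window N k f‖ ^ 2 := by
        gcongr with k
        refine (sum_sq_norm_le _ _).trans ?_
        rw [← mul_pow]
        gcongr
        exact Y.le_opNorm _
      _ = N * (‖Y‖ ^ 2 * ∑ k ∈ Finset.range (n + N), ‖window N k f‖ ^ 2) := by
        rw [← Finset.mul_sum]
      _ ≤ N * (‖Y‖ ^ 2 * (N * ‖f‖ ^ 2)) := by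
        gcongr
        exact sum_sq_norm_window_le _ _ _
      _ = N ^ 2 * (‖Y‖ * ‖f‖) ^ 2 := by ring
  exact le_of_mul_le_mul_left h3 (by positivity)

end Entries

/-! ### Operators intertwining `A ⊗ S` and `lam (A ⊗ S)` -/

section Intertwining

variable {K : Type u} [NormedAddCommGroup K] [InnerProductSpace ℂ K]

theorem tensorShift_single (A : K →L[ℂ] K) (j : ℕ) (x : K) :
    tensorShift A (lp.single 2 j x) = lp.single 2 (j + 1) (A x) := by
  ext i
  cases i with
  | zero => rw [tensorShift_apply_zero, lp.single_apply_ne _ _ _ (Nat.succ_ne_zero j).symm]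
  | succ i =>
    rw [tensorShift_apply_succ]
    by_cases h : i = j
    · subst h
      rw [lp.single_apply_self, lp.single_apply_self]
    · rw [lp.single_apply_ne _ _ _ h, lp.single_apply_ne _ _ _ (by omega), map_zero]

variable {A : K →L[ℂ] K} {lam : ℂ} {Y : HardyTensor K →L[ℂ] HardyTensor K}

/-- Coordinate `i + 1` of the intertwining relation on a vector supported at `j`. -/
theorem entry_succ_succ (hlam : lam ≠ 0)
    (hW : ∀ f, tensorShift A (Y f) = lam • Y (tensorShift A f)) (i j : ℕ) (x : K) :
    entry Y (i + 1) (j + 1) (A x) = lam⁻¹ • A (entry Y i j x) := by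
  have h := congrArg (fun f : HardyTensor K => f (i + 1)) (hW (lp.single 2 j x))
  rw [tensorShift_single] at h
  rw [eq_inv_smul_iff₀ hlam]
  exact h.symm

/-- Descending along the diagonal ends in row `0`, where the relation reads `0 = λ Y_{0,j+1} A`
because `A ⊗ S` has zero first coordinate. An operator vanishing on the dense range of `A` is zero.
-/
theorem entry_eq_zero_of_lt (hA : DenseRange A) (hlam : lam ≠ 0)
    (hW : ∀ f, tensorShift A (Y f) = lam • Y (tensorShift A f)) {i j : ℕ} (hij : i < j) :
    entry Y i j = 0 := by
  have key : ∀ Z : K →L[ℂ] K, (∀ x, Z (A x) = 0) → Z = 0 := fun Z hZ =>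
    ContinuousLinearMap.ext fun x => hA.induction_on (p := fun x => Z x = 0) x
      (isClosed_eq (by fun_prop) (by fun_prop)) hZ
  induction i generalizing j with
  | zero =>
    obtain ⟨j, rfl⟩ := Nat.exists_eq_add_of_lt hij
    refine key _ fun x => ?_
    have h := congrArg (fun f : HardyTensor K => f 0) (hW (lp.single 2 (0 + j) x))
    rw [tensorShift_single] at h
    have h' : (0 : K) = lam • entry Y 0 (0 + j + 1) (A x) := (tensorShift_apply_zero A _).symm.trans h
    exact (smul_eq_zero.mp h'.symm).resolve_left hlam
  | succ i ih =>
    obtain ⟨k, rfl⟩ := Nat.exists_eq_succ_of_ne_zero (Nat.ne_zero_of_lt hij)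
    refine key _ fun x => ?_
    rw [Nat.succ_eq_add_one, entry_succ_succ hlam hW, ih (Nat.lt_of_succ_lt_succ hij)]
    simp

theorem entry_add_apply_pow (hlam : lam ≠ 0)
    (hW : ∀ f, tensorShift A (Y f) = lam • Y (tensorShift A f)) (m j : ℕ) (x : K) :
    entry Y (m + j) j ((A ^ j) x) = (lam⁻¹ ^ j) • (A ^ j) (entry Y m 0 x) := by
  induction j with
  | zero => simp
  | succ j ih =>
    rw [pow_succ' A, mul_apply_eq_comp, ← add_assoc, entry_succ_succ hlam hW, ih, map_smul,
      smul_smul, ← pow_succ', mul_apply_eq_comp]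

/-- The vector `λ⁻ⁿ Aⁿ L x` is `Y_{m+n,n} Aⁿ x`, so `c = ‖Y‖` serves for every `n`. -/
theorem entry_mem_deddens (hlam : lam ≠ 0)
    (hW : ∀ f, tensorShift A (Y f) = lam • Y (tensorShift A f)) (m : ℕ) :
    entry Y m 0 ∈ deddens ‖lam‖ A A := by
  refine ⟨‖Y‖, Y.opNorm_nonneg, fun x n => ?_⟩
  refine le_trans (le_of_eq ?_) (norm_entry_apply_le Y (m + n) n ((A ^ n) x))
  rw [entry_add_apply_pow hlam hW, norm_smul, norm_smul]
  simp

variable [CompleteSpace K]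

/-- Both sides agree on the dense range of `A ^ j`. Thus the `m`-th diagonal of `Y` is exactly the
generator built from `Y_{m,0}`. -/
theorem diagEntry_entry (hA : ∀ n : ℕ, DenseRange (A ^ n : K →L[ℂ] K)) (hlam : lam ≠ 0)
    (hW : ∀ f, tensorShift A (Y f) = lam • Y (tensorShift A f)) (m j : ℕ) :
    diagEntry A lam (entry Y m 0) j = entry Y (m + j) j := by
  refine ContinuousLinearMap.ext fun x => (hA j).induction_on
    (p := fun x => diagEntry A lam (entry Y m 0) j x = entry Y (m + j) j x) x
    (isClosed_eq (by fun_prop) (by fun_prop)) fun z => ?_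
  rw [diagEntry_apply hA (entry_mem_deddens hlam hW m), entry_add_apply_pow hlam hW]

theorem diagEntry_succ_apply (hA : ∀ n : ℕ, DenseRange (A ^ n : K →L[ℂ] K)) {L : K →L[ℂ] K}
    (hL : L ∈ deddens ‖lam‖ A A) (n : ℕ) (x : K) :
    diagEntry A lam L (n + 1) (A x) = lam⁻¹ • A (diagEntry A lam L n x) := by
  refine (hA n).induction_on
    (p := fun x => diagEntry A lam L (n + 1) (A x) = lam⁻¹ • A (diagEntry A lam L n x)) x
    (isClosed_eq (by fun_prop) (by fun_prop)) fun z => ?_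
  rw [← mul_apply_eq_comp A, ← pow_succ', diagEntry_apply hA hL, diagEntry_apply hA hL, map_smul,
    smul_smul, ← pow_succ', ← mul_apply_eq_comp A, ← pow_succ']

/-- The operators `(I ⊗ Sᵐ) diag(L, X₁₁, X₂₂, …)` intertwine `A ⊗ S` and `lam (A ⊗ S)`. -/
theorem tensorShift_shift_pow_diag (hA : ∀ n : ℕ, DenseRange (A ^ n : K →L[ℂ] K)) (hlam : lam ≠ 0)
    {L : K →L[ℂ] K} (hL : L ∈ deddens ‖lam‖ A A) (m : ℕ) (f : HardyTensor K) :
    tensorShift A ((shift K ^ m) (diag (diagEntry A lam L) (diagEntry_bounded hA hL) f)) =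
      lam • (shift K ^ m) (diag (diagEntry A lam L) (diagEntry_bounded hA hL)
        (tensorShift A f)) := by
  ext i
  rw [lp.coeFn_smul, Pi.smul_apply]
  cases i with
  | zero =>
    rw [tensorShift_apply_zero, shift_pow_apply]
    split_ifs
    · simp
    · simp
  | succ i =>
    rw [tensorShift_apply_succ, shift_pow_apply, shift_pow_apply]
    rcases lt_trichotomy (i + 1) m with h | h | h
    · rw [if_neg (by omega), if_neg (by omega), map_zero, smul_zero]
    -- Boundary row `i + 1 = m`: the right side reads the zeroth coordinate of `A ⊗ S`, which is
    -- zero.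
    · rw [if_neg (by omega), if_pos (by omega), h, Nat.sub_self, diag_apply,
        tensorShift_apply_zero, map_zero, map_zero, smul_zero]
    · rw [if_pos (by omega), if_pos (by omega), Nat.succ_sub (by omega : m ≤ i), diag_apply,
        diag_apply, Nat.succ_eq_add_one, tensorShift_apply_succ, diagEntry_succ_apply hA hL,
        smul_inv_smul₀ hlam]

/-- The Fejér mean of order `N` of the expansion of `Y` into its diagonals. -/
def fejerMean (hA : ∀ n : ℕ, DenseRange (A ^ n : K →L[ℂ] K)) (hlam : lam ≠ 0)
    (hW : ∀ f, tensorShift A (Y f) = lam • Y (tensorShift A f)) (N : ℕ) :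
    HardyTensor K →L[ℂ] HardyTensor K :=
  ∑ m ∈ Finset.range N, (((N - m : ℕ) : ℂ) / N) • ((shift K ^ m) ∘L
    diag (diagEntry A lam (entry Y m 0)) (diagEntry_bounded hA (entry_mem_deddens hlam hW m)))

theorem fejerMean_apply (hA : ∀ n : ℕ, DenseRange (A ^ n : K →L[ℂ] K)) (hlam : lam ≠ 0)
    (hW : ∀ f, tensorShift A (Y f) = lam • Y (tensorShift A f)) (N : ℕ) (f : HardyTensor K)
    (i : ℕ) :
    fejerMean hA hlam hW N f i = ∑ m ∈ Finset.range N, (((N - m : ℕ) : ℂ) / N) •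
      if m ≤ i then entry Y i (i - m) (f (i - m)) else 0 := by
  rw [fejerMean, sum_apply, lp.coeFn_sum, Finset.sum_apply]
  refine Finset.sum_congr rfl fun m _ => ?_
  rw [smul_apply, lp.coeFn_smul, Pi.smul_apply, ContinuousLinearMap.comp_apply,
    shift_pow_apply]
  congr 1
  split_ifs with h
  · rw [diag_apply, diagEntry_entry hA hlam hW, Nat.add_sub_cancel' h]
  · rfl

theorem norm_fejerMean_le (hA : ∀ n : ℕ, DenseRange (A ^ n : K →L[ℂ] K)) (hlam : lam ≠ 0)
    (hW : ∀ f, tensorShift A (Y f) = lam • Y (tensorShift A f)) (N : ℕ) :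
    ‖fejerMean hA hlam hW N‖ ≤ ‖Y‖ := by
  rcases eq_or_ne N 0 with rfl | hN
  · simp [fejerMean]
  refine ContinuousLinearMap.opNorm_le_bound _ Y.opNorm_nonneg fun f => ?_
  refine norm_fejer_le (fun i j hij => entry_eq_zero_of_lt (by simpa using hA 1) hlam hW hij) hN
    fun i => ?_
  rw [fejerMean_apply, Finset.smul_sum]
  refine Finset.sum_congr rfl fun m _ => ?_
  rw [smul_smul, mul_div_cancel₀ _ (Nat.cast_ne_zero.mpr hN), Nat.cast_smul_eq_nsmul]

open Filter Topology in
-- Only the diagonals `m ≤ i` reach coordinate `i`, so for `N > i` this is a fixed finite sum whose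
-- weights `(N - m) / N` tend to `1`.
theorem tendsto_fejerMean_apply (hA : ∀ n : ℕ, DenseRange (A ^ n : K →L[ℂ] K)) (hlam : lam ≠ 0)
    (hW : ∀ f, tensorShift A (Y f) = lam • Y (tensorShift A f)) (f : HardyTensor K) (i : ℕ) :
    Tendsto (fun N => fejerMean hA hlam hW N f i) atTop (𝓝 (Y f i)) := by
  rw [apply_eq_sum_entry fun i j hij =>
    entry_eq_zero_of_lt (by simpa using hA 1) hlam hW hij]
  have h1 : Tendsto (fun N : ℕ => ∑ m ∈ Finset.range (i + 1),
      (((N - m : ℕ) : ℂ) / N) • entry Y i (i - m) (f (i - m))) atTop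
      (𝓝 (∑ m ∈ Finset.range (i + 1), (1 : ℂ) • entry Y i (i - m) (f (i - m)))) := by
    refine tendsto_finsetSum _ fun m _ => Tendsto.smul_const ?_ _
    have h2 : Tendsto (fun N : ℕ => (1 : ℂ) - m / N) atTop (𝓝 (1 - 0)) :=
      tendsto_const_nhds.sub (tendsto_const_div_atTop_nhds_zero_nat (m : ℂ))
    rw [sub_zero] at h2
    refine h2.congr' ?_
    filter_upwards [eventually_gt_atTop m] with N hN
    have hN0 : (N : ℂ) ≠ 0 := Nat.cast_ne_zero.mpr (by omega)
    rw [Nat.cast_sub hN.le, sub_div, div_self hN0]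
  simp only [one_smul] at h1
  refine h1.congr' ?_
  filter_upwards [eventually_gt_atTop i] with N hN
  rw [fejerMean_apply, ← Finset.sum_subset (Finset.range_subset_range.mpr hN)]
  · refine Finset.sum_congr rfl fun m hm => ?_
    rw [if_pos (Nat.lt_succ_iff.mp (Finset.mem_range.mp hm))]
  · intro m _ hm
    rw [if_neg (by simpa [Nat.lt_succ_iff] using hm), smul_zero]

end Intertwining

/-! ### The extended eigenspaces -/

/-- The relation is linear in `X`, so the extended eigenvectors together with `0` already form a
subspace. -/
theorem mem_extEigenspace {H : Type u} [NormedAddCommGroup H] [InnerProductSpace ℂ H]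
    {T : H →L[ℂ] H} {lam : ℂ} {X : H →L[ℂ] H} :
    X ∈ extEigenspace T lam ↔ T ∘L X = lam • (X ∘L T) := by
  constructor
  · intro h
    induction h using Submodule.span_induction with
    | mem X hX => exact hX.2
    | zero => simp
    | add X Y _ _ hX hY =>
      rw [ContinuousLinearMap.comp_add, ContinuousLinearMap.add_comp, hX, hY, smul_add]
    | smul c X _ hX =>
      rw [ContinuousLinearMap.comp_smul, ContinuousLinearMap.smul_comp, hX, smul_comm]
  · intro h
    by_cases h0 : X = 0
    · rw [h0]
      exact zero_mem _
    · exact Submodule.subset_span ⟨h0, h⟩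

/-- For `λ = 0` the relation is `T X = 0`, and `T` is injective. -/
theorem ne_zero_of_mem_extSpectrum {T : H →L[ℂ] H} (hT : IsPureQuasinormal T) {lam : ℂ}
    (hlam : lam ∈ extSpectrum T) : lam ≠ 0 := by
  rintro rfl
  obtain ⟨X, hX0, hX⟩ := hlam
  refine hX0 (ContinuousLinearMap.ext fun x => ?_)
  have h : X x ∈ LinearMap.ker T.toLinearMap := by
    have := congrArg (fun Z : H →L[ℂ] H => Z x) hX
    simpa using this
  rwa [ker_eq_bot T hT, Submodule.mem_bot] at h

theorem weakStarSpan_generators_subset {T : H →L[ℂ] H} (hT : IsPureQuasinormal T) {lam : ℂ}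
    (hlam : lam ≠ 0) {U : H ≃ₗᵢ[ℂ] HardyTensor (defectSpace T)} (hU : IsModelUnitary T hT U) :
    weakStarSpan (generators T hT lam U) ⊆ extEigenspace T lam := by
  have hset : (extEigenspace T lam : Set (H →L[ℂ] H)) = {X | T ∘L X = lam • (X ∘L T)} :=
    Set.ext fun X => mem_extEigenspace
  have hspan : Submodule.span ℂ (generators T hT lam U) ≤ extEigenspace T lam := by
    refine Submodule.span_le.mpr ?_
    rintro _ ⟨m, L, hL, rfl⟩
    refine mem_extEigenspace.mpr (ContinuousLinearMap.ext fun x => U.injective ?_)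
    have h := tensorShift_shift_pow_diag (denseRange_defectOp_pow T hT) hlam hL m (U x)
    rw [← hU, ← hU, U.symm_apply_apply] at h
    simp only [smul_apply, map_smul]
    refine h.trans ?_
    congr 1
    exact (U.apply_symm_apply _).symm
  have hcl := isClosed_weakStar_setOf_intertwining T lam
  rw [← hset] at hcl
  exact (@IsClosed.closure_subset_iff _ (weakStarTopology H) _ _ hcl).mpr hspan

open Filter Topology in
-- The Fejér means of `U X U*`, transported back to `H`, are combinations of generators and form a
-- bounded sequence converging weak* to `X`.
theorem extEigenspace_subset_weakStarSpan {T : H →L[ℂ] H} (hT : IsPureQuasinormal T) {lam : ℂ}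
    (hlam : lam ≠ 0) {U : H ≃ₗᵢ[ℂ] HardyTensor (defectSpace T)} (hU : IsModelUnitary T hT U) :
    (extEigenspace T lam : Set (H →L[ℂ] H)) ⊆ weakStarSpan (generators T hT lam U) := by
  intro X hX
  have hX' := mem_extEigenspace.mp hX
  let Y : HardyTensor (defectSpace T) →L[ℂ] HardyTensor (defectSpace T) :=
    (U.toContinuousLinearEquiv : H →L[ℂ] HardyTensor (defectSpace T)) ∘L X ∘L
      (U.symm.toContinuousLinearEquiv : HardyTensor (defectSpace T) →L[ℂ] H)
  have hY : ∀ f, Y f = U (X (U.symm f)) := fun _ => rfl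
  have hA := denseRange_defectOp_pow T hT
  have hW : ∀ f, tensorShift (defectOp T hT) (Y f) = lam • Y (tensorShift (defectOp T hT) f) := by
    intro f
    rw [← hU, ← hU, hY, hY, U.symm_apply_apply, U.symm_apply_apply, ← map_smul]
    exact congrArg (fun Z : H →L[ℂ] H => U (Z (U.symm f))) hX'
  let G : ℕ → H →L[ℂ] H := fun N =>
    (U.symm.toContinuousLinearEquiv : HardyTensor (defectSpace T) →L[ℂ] H) ∘L
      fejerMean hA hlam hW N ∘L (U.toContinuousLinearEquiv : H →L[ℂ] HardyTensor (defectSpace T))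
  have hG : ∀ N x, G N x = U.symm (fejerMean hA hlam hW N (U x)) := fun _ _ => rfl
  have hmem : ∀ N, G N ∈ Submodule.span ℂ (generators T hT lam U) := by
    intro N
    have : G N = ∑ m ∈ Finset.range N, (((N - m : ℕ) : ℂ) / N) •
        ((U.symm.toContinuousLinearEquiv : HardyTensor (defectSpace T) →L[ℂ] H) ∘L
          ((shift (defectSpace T) ^ m) ∘L diagOp T hT lam (entry Y m 0)
            (entry_mem_deddens hlam hW m)) ∘L
          (U.toContinuousLinearEquiv : H →L[ℂ] HardyTensor (defectSpace T))) := by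
      refine ContinuousLinearMap.ext fun x => ?_
      rw [hG, fejerMean, sum_apply, sum_apply, map_sum]
      refine Finset.sum_congr rfl fun m _ => ?_
      rw [smul_apply, map_smul]
      rfl
    rw [this]
    exact Submodule.sum_mem _ fun m _ => Submodule.smul_mem _ _
      (Submodule.subset_span ⟨m, _, entry_mem_deddens hlam hW m, rfl⟩)
  have hbound : ∀ N f, ‖fejerMean hA hlam hW N f‖ ≤ ‖Y‖ * ‖f‖ := fun N f =>
    (fejerMean hA hlam hW N).le_of_opNorm_le (norm_fejerMean_le hA hlam hW N) f
  have hlim : Tendsto G atTop (@nhds _ (weakStarTopology H) X) := by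
    refine tendsto_weakStar_of_bounded (C := ‖Y‖) (fun N => ?_) fun x y => ?_
    · refine ContinuousLinearMap.opNorm_le_bound _ Y.opNorm_nonneg fun x => ?_
      rw [hG, U.symm.norm_map, ← U.norm_map x]
      exact hbound N (U x)
    · have h := tendsto_inner_of_tendsto_coord (fun N => hbound N (U x))
        (tendsto_fejerMean_apply hA hlam hW (U x)) (U y)
      rw [hY, U.symm_apply_apply, U.inner_map_map] at h
      refine h.congr fun N => ?_
      rw [hG, ← U.inner_map_map, U.apply_symm_apply]
  let := weakStarTopology H
  exact mem_closure_of_tendsto hlim (Eventually.of_forall hmem)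

end ExtEig

end

theorem theorem4p1 {H : Type*} [NormedAddCommGroup H] [InnerProductSpace ℂ H] [CompleteSpace H]
    (T : H →L[ℂ] H) (hT : ExtEig.IsPureQuasinormal T)
    (lam : ℂ) (hlam : lam ∈ ExtEig.extSpectrum T) :
    (∃ U : H ≃ₗᵢ[ℂ] ExtEig.HardyTensor (ExtEig.defectSpace T), ExtEig.IsModelUnitary T hT U) ∧
    ∀ U : H ≃ₗᵢ[ℂ] ExtEig.HardyTensor (ExtEig.defectSpace T), ExtEig.IsModelUnitary T hT U →
      (ExtEig.extEigenspace T lam : Set (H →L[ℂ] H)) =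
        ExtEig.weakStarSpan (ExtEig.generators T hT lam U) :=
  have hlam0 := ExtEig.ne_zero_of_mem_extSpectrum hT hlam
  ⟨ExtEig.exists_isModelUnitary hT, fun _ hU =>
    (ExtEig.extEigenspace_subset_weakStarSpan hT hlam0 hU).antisymm
      (ExtEig.weakStarSpan_generators_subset hT hlam0 hU)⟩
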